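/- Let $p$ be a prime and $S$ a finite $p$-group. Definitions. A *fusion system* $\mathcal F$ on $S$ is a category whose objects are the subgroups of $S$, with $\operatorname{Hom}_S(P,Q)\subseteq\operatorname{Hom}_{\mathcal F}(P,Q)\subseteq\operatorname{Inj}(P,Q)$ for all $P,Q\le S$ (where $\operatorname{Hom}_S(P,Q)$ consists of the maps induced by conjugation by elements of $S$ and $\operatorname{Inj}(P,Q)$ of the injective homomorphisms), and in which every morphism is an $\mathcal F$-isomorphism onto its image followed by an inclusion. Write $P^{\mathcal F}$ for the set of images of $P$ under morphisms in $\operatorname{Hom}_{\mathcal F}(P,S)$, and $\operatorname{Aut}_S(P)\le\operatorname{Aut}_{\mathcal F}(P)$ for the automorphisms of $P$ induced by $N_S(P)$, respectively lying in $\mathcal F$. * $P$ is *$S$-centric* if $C_S(P)=Z(P)$, and *$\mathcal F$-centric* if every $Q\in P^{\mathcal F}$ is $S$-centric; $P$ is *fully $\mathcal F$-normalized* if $|N_S(P)|\ge|N_S(Q)|$ for all $Q\in P^{\mathcal F}$; $P$ is *fully $\mathcal F$-automized* if $\operatorname{Aut}_S(P)\in\operatorname{Syl}_p(\operatorname{Aut}_{\mathcal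 F}(P))$. * $Q$ is *$\mathcal F$-receptive* if every $\mathcal F$-isomorphism $\alpha\colon P\to Q$ extends to a morphism in $\operatorname{Hom}_{\mathcal F}(N_\alpha,S)$, where $N_\alpha=\{g\in N_S(P)\mid \alpha c_g\alpha^{-1}\in\operatorname{Aut}_S(Q)\}$, $c_g$ being the conjugation map of $g$ on $P$. $\mathcal F$ is *saturated* if for every $P\le S$ some $Q\in P^{\mathcal F}$ is fully $\mathcal F$-automized and $\mathcal F$-receptive. * A subgroup $M<H$ of a finite group $H$ is *strongly $p$-embedded* if $p$ divides $|M|$ and $p\nmid|M\cap hMh^{-1}|$ for all $h\in H\setminus M$. $P$ is *$\mathcal F$-essential* if $P<S$, $P$ is $\mathcal F$-centric and fully $\mathcal F$-normalized, and $\operatorname{Aut}_{\mathcal F}(P)/\operatorname{Inn}(P)$ has a strongly $p$-embedded subgroup. * A *fusion datum* on $S$ is a pair $\mathcal D=(\mathcal Q,\mathcal A)$, where $\mathcal Q$ is a finite sequence of $S$-centric subgroups of $S$ with first element $S$, $\mathcal A$ assigns to each $Q\in\mathcal Q$ a subgroup $\mathcal A(Q)\le\operatorname{Aut}(Q)$ containing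 $\operatorname{Aut}_S(Q)$, and no two members of $\mathcal Q$ are in the same $\mathcal A(S)$-orbit. $\mathcal F(\mathcal D)$ is the smallest fusion system on $S$ containing $\mathcal A(Q)$ for every $Q\in\mathcal Q$. * $\mathcal D$ is an *automizer sequence* if, with $\mathcal F=\mathcal F(\mathcal D)$, for each $Q\in\mathcal Q$: $\mathcal A(Q)=\operatorname{Aut}_{\mathcal F}(Q)$; $Q$ is $\mathcal F$-centric; $\operatorname{Aut}_S(Q)\in\operatorname{Syl}_p(\mathcal A(Q))$; and, if $Q\ne S$, $\mathcal A(Q)/\operatorname{Inn}(Q)$ has a strongly $p$-embedded subgroup. * $\mathcal D$ is an *Alperin sequence associated to* a saturated fusion system $\mathcal F$ on $S$ if every member of $\mathcal Q$ is $S$ or $\mathcal F$-essential, every $\mathcal F$-conjugacy class that contains an $\mathcal F$-essential subgroup has an $\mathcal F$-essential representative in $\mathcal Q$, and $\mathcal A(Q)=\operatorname{Aut}_{\mathcal F}(Q)$ for each $Q\in\mathcal Q$. Proposition. Let $\mathcal D$ be a fusion datum on $S$. 1. If $\mathcal D$ is an automizer sequence and $\mathcal F(\mathcal D)$ is saturated,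 then $\mathcal D$ is an Alperin sequence associated to $\mathcal F(\mathcal D)$. 2. Conversely, if $\mathcal D$ is an Alperin sequence associated to a saturated fusion system $\mathcal F$ on $S$, then $\mathcal D$ is an automizer sequence and $\mathcal F=\mathcal F(\mathcal D)$. -/

import Mathlib

namespace Fusion

variable {S : Type*} [Group S]

/-! Maps are written on the left, and the conjugation map of `g` is `x ↦ g * x * g⁻¹`. -/

/-- The image, as a subgroup of `S`, of a homomorphism between subgroups of `S`. -/
def image {P Q : Subgroup S} (φ : P →* Q) : Subgroup S :=
  (Q.subtype.comp φ).range

/-- `Hom_S(P, Q)`: the homomorphisms `P → Q` induced by conjugation by an element of `S`. -/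
def homS (P Q : Subgroup S) : Set (P →* Q) :=
  {φ | ∃ g : S, ∀ x : P, (φ x : S) = g * x * g⁻¹}

/-- A fusion system on `S`: a category whose objects are the subgroups of `S`, with
`Hom_S(P, Q) ⊆ Hom(P, Q) ⊆ Inj(P, Q)` and with the usual composition (identities and inclusions
belong to `Hom_S`), in which every morphism is an isomorphism of the category onto its image
followed by the inclusion of the image. -/
@[ext]
structure FusionSystem (S : Type*) [Group S] where
  hom : (P Q : Subgroup S) → Set (P →* Q)
  comp_mem : ∀ {P Q R : Subgroup S} {φ : P →* Q} {ψ : Q →* R},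
    φ ∈ hom P Q → ψ ∈ hom Q R → ψ.comp φ ∈ hom P R
  homS_subset : ∀ P Q : Subgroup S, homS P Q ⊆ hom P Q
  injective : ∀ {P Q : Subgroup S} {φ : P →* Q}, φ ∈ hom P Q → Function.Injective φ
  factor : ∀ {P Q : Subgroup S} {φ : P →* Q}, φ ∈ hom P Q →
    ∃ e : P ≃* image φ, (∀ x : P, (e x : S) = φ x) ∧
      e.toMonoidHom ∈ hom P (image φ) ∧ e.symm.toMonoidHom ∈ hom (image φ) P

/-- `Aut_S(P)`: the automorphisms of `P` induced by conjugation by elements of `N_S(P)`. -/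
def autS (P : Subgroup S) : Subgroup (MulAut P) :=
  P.normalizerMonoidHom.range

/-- `Inn(G)`. -/
def inn (G : Type*) [Group G] : Subgroup (MulAut G) :=
  (MulAut.conj : G →* MulAut G).range

instance inn_normal (G : Type*) [Group G] : (inn G).Normal := by
  refine ⟨?_⟩
  rintro _ ⟨g, rfl⟩ a
  refine ⟨a g, ?_⟩
  ext x
  simp [MulAut.mul_apply]

/-- `A / Inn(G)` for a group of automorphisms `A` of `G` (used when `Inn(G) ≤ A`). -/
abbrev Out {G : Type*} [Group G] (A : Subgroup (MulAut G)) : Type _ :=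
  A ⧸ (inn G).subgroupOf A

/-- `T` is a Sylow `p`-subgroup of the subgroup `A`. -/
def IsSylowOf (p : ℕ) {G : Type*} [Group G] (T A : Subgroup G) : Prop :=
  ∃ U : Sylow p A, (U : Subgroup A).map A.subtype = T

/-- The (finite) group `H` has a strongly `p`-embedded subgroup: a proper subgroup `M` of order
divisible by `p` such that `M ∩ hMh⁻¹` has order prime to `p` for all `h ∉ M`. -/
def HasStronglyEmbedded (p : ℕ) (H : Type*) [Group H] : Prop :=
  ∃ M : Subgroup H, M ≠ ⊤ ∧ p ∣ Nat.card M ∧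
    ∀ h : H, h ∉ M → ¬ p ∣ Nat.card (M ⊓ M.map (MulAut.conj h).toMonoidHom : Subgroup H)

/-- `P` is `S`-centric: `C_S(P) = Z(P)`. -/
def IsCentricIn (P : Subgroup S) : Prop :=
  Subgroup.centralizer (P : Set S) = (Subgroup.center P).map P.subtype

/-- The extension control subgroup `N_α` of an isomorphism `α : P → Q`: the elements `g` of
`N_S(P)` for which `α ∘ c_g ∘ α⁻¹` lies in `Aut_S(Q)`. -/
def extControl {P Q : Subgroup S} (α : P ≃* Q) : Subgroup S :=
  ((autS Q).comap ((MulAut.congr α).toMonoidHom.comp P.normalizerMonoidHom)).map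
    (Subgroup.normalizer (P : Set S)).subtype

theorem le_extControl {P Q : Subgroup S} (α : P ≃* Q) : P ≤ extControl α := by
  intro x hx
  refine ⟨⟨x, Subgroup.le_normalizer hx⟩, ?_, rfl⟩
  refine ⟨⟨α ⟨x, hx⟩, Subgroup.le_normalizer (α ⟨x, hx⟩).2⟩, ?_⟩
  ext y
  have h : P.normalizerMonoidHom ⟨x, Subgroup.le_normalizer hx⟩ (α.symm y)
      = ⟨x, hx⟩ * α.symm y * ⟨x, hx⟩⁻¹ := rfl
  have h' : (MulAut.congr α) (P.normalizerMonoidHom ⟨x, Subgroup.le_normalizer hx⟩) y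
      = α (P.normalizerMonoidHom ⟨x, Subgroup.le_normalizer hx⟩ (α.symm y)) := rfl
  change ((α ⟨x, hx⟩ : S) * y * (α ⟨x, hx⟩ : S)⁻¹) =
    ((MulAut.congr α) (P.normalizerMonoidHom ⟨x, Subgroup.le_normalizer hx⟩) y : Q)
  rw [h', h]
  simp

namespace FusionSystem

theorem refl_mem (F : FusionSystem S) (P : Subgroup S) : MonoidHom.id P ∈ F.hom P P :=
  F.homS_subset P P ⟨1, fun x => by simp⟩

theorem symm_mem (F : FusionSystem S) {P : Subgroup S} {a : MulAut P}
    (ha : a.toMonoidHom ∈ F.hom P P) : a.symm.toMonoidHom ∈ F.hom P P := by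
  obtain ⟨e, he, -, hs⟩ := F.factor ha
  have hle : P ≤ image a.toMonoidHom := by
    intro x hx
    refine ⟨a.symm ⟨x, hx⟩, ?_⟩
    simp
  have hi : Subgroup.inclusion hle ∈ F.hom P (image a.toMonoidHom) :=
    F.homS_subset _ _ ⟨1, fun x => by simp; rfl⟩
  have hc := F.comp_mem hi hs
  convert hc using 1
  ext x
  have : a (e.symm (Subgroup.inclusion hle x)) = x := by
    apply Subtype.ext
    have := he (e.symm (Subgroup.inclusion hle x))
    rw [MulEquiv.apply_symm_apply] at this
    exact this.symm
  have h2 : a.symm x = e.symm (Subgroup.inclusion hle x) := by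
    rw [MulEquiv.symm_apply_eq]; exact this.symm
  exact congrArg Subtype.val h2

/-- `Aut_F(P)`. -/
def aut (F : FusionSystem S) (P : Subgroup S) : Subgroup (MulAut P) where
  carrier := {a | a.toMonoidHom ∈ F.hom P P}
  one_mem' := F.refl_mem P
  mul_mem' := fun ha hb => F.comp_mem hb ha
  inv_mem' := fun ha => F.symm_mem ha

/-- `Q` belongs to the `F`-conjugacy class `P^F` of `P`. -/
def Conj (F : FusionSystem S) (P Q : Subgroup S) : Prop :=
  ∃ φ ∈ F.hom P ⊤, image φ = Q

/-- `|N_S(P)| ≥ |N_S(Q)|` for all `Q ∈ P^F`. -/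
def IsFullyNormalized (F : FusionSystem S) (P : Subgroup S) : Prop :=
  ∀ Q, F.Conj P Q →
    Nat.card (Subgroup.normalizer (Q : Set S)) ≤ Nat.card (Subgroup.normalizer (P : Set S))

/-- `Aut_S(P)` is a Sylow `p`-subgroup of `Aut_F(P)`. -/
def IsFullyAutomized (p : ℕ) (F : FusionSystem S) (P : Subgroup S) : Prop :=
  IsSylowOf p (autS P) (F.aut P)

/-- Every member of `P^F` is `S`-centric. -/
def IsCentric (F : FusionSystem S) (P : Subgroup S) : Prop :=
  ∀ Q, F.Conj P Q → IsCentricIn Q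

/-- `P` is `F`-essential. -/
structure IsEssential (p : ℕ) (F : FusionSystem S) (P : Subgroup S) : Prop where
  lt_top : P < ⊤
  centric : F.IsCentric P
  fullyNormalized : F.IsFullyNormalized P
  stronglyEmbedded : HasStronglyEmbedded p (Out (F.aut P))

/-- Every `F`-isomorphism `α : P → Q` extends to a morphism `N_α → S` of `F`. -/
def IsReceptive (F : FusionSystem S) (Q : Subgroup S) : Prop :=
  ∀ (P : Subgroup S) (α : P ≃* Q), α.toMonoidHom ∈ F.hom P Q →
    ∃ β ∈ F.hom (extControl α) ⊤,
      ∀ x : P, (β (Subgroup.inclusion (le_extControl α) x) : S) = α x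

/-- Every subgroup of `S` is `F`-conjugate to one that is fully `F`-automized and `F`-receptive. -/
def IsSaturated (p : ℕ) (F : FusionSystem S) : Prop :=
  ∀ P : Subgroup S, ∃ Q, F.Conj P Q ∧ F.IsFullyAutomized p Q ∧ F.IsReceptive Q

/-- The universal fusion system, consisting of all injective homomorphisms. -/
def universal (S : Type*) [Group S] : FusionSystem S where
  hom P Q := {φ | Function.Injective φ}
  comp_mem := fun h₁ h₂ => h₂.comp h₁
  homS_subset := by
    rintro P Q φ ⟨g, hg⟩ x y hxy
    have h : (φ x : S) = φ y := by rw [hxy]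
    rw [hg, hg] at h
    exact Subtype.ext (by simpa using h)
  injective := fun h => h
  factor := by
    intro P Q φ h
    have h' : Function.Injective (Q.subtype.comp φ) := Q.subtype_injective.comp h
    exact ⟨MonoidHom.ofInjective h', fun x => rfl, MulEquiv.injective _, MulEquiv.injective _⟩

/-- `⟨X⟩` for a family `X` of sets of automorphisms of subgroups of `S`: the smallest fusion
system on `S` containing them, that is, the intersection of all fusion systems containing them. -/
def generate (X : (P : Subgroup S) → Set (MulAut P)) : FusionSystem S where
  hom P Q := {φ | ∀ G : FusionSystem S,
    (∀ R : Subgroup S, ∀ a ∈ X R, a.toMonoidHom ∈ G.hom R R) → φ ∈ G.hom P Q}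
  comp_mem := fun h₁ h₂ G hG => G.comp_mem (h₁ G hG) (h₂ G hG)
  homS_subset := fun P Q _ h G _ => G.homS_subset P Q h
  injective := fun h => h (universal S) fun _ a _ => a.injective
  factor := by
    intro P Q φ h
    obtain ⟨e, he, -, -⟩ :=
      (universal S).factor (h (universal S) fun _ a _ => a.injective)
    refine ⟨e, he, fun G hG => ?_, fun G hG => ?_⟩
    all_goals
      obtain ⟨e', he', h₁, h₂⟩ := G.factor (h G hG)
      obtain rfl : e = e' := by
        ext x
        rw [he, he']
      assumption

end FusionSystem

/-- A fusion datum on `S`: a finite sequence `seq` of `S`-centric subgroups of `S` with first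
element `S`, and for each member `Q` a group `A Q` of automorphisms of `Q` containing `Aut_S(Q)`,
such that no two members of the sequence are in the same `A(S)`-orbit. -/
structure FusionDatum (S : Type*) [Group S] where
  seq : List (Subgroup S)
  head_eq : seq.head? = some ⊤
  centric : ∀ Q ∈ seq, IsCentricIn Q
  A : (Q : Subgroup S) → Q ∈ seq → Subgroup (MulAut Q)
  autS_le : ∀ (Q : Subgroup S) (hQ : Q ∈ seq), autS Q ≤ A Q hQ
  orbit : seq.Pairwise fun P Q => ∀ a ∈ A ⊤ (List.mem_of_head? head_eq),
    ((P.subgroupOf ⊤).map a.toMonoidHom).map (⊤ : Subgroup S).subtype ≠ Q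

namespace FusionDatum

/-- `F(D)`: the smallest fusion system on `S` containing `A(Q)` for every member `Q`. -/
def fusionSystem (D : FusionDatum S) : FusionSystem S :=
  FusionSystem.generate fun Q => {a | ∃ hQ : Q ∈ D.seq, a ∈ D.A Q hQ}

/-- `D` is an automizer sequence on `S`. -/
structure IsAutomizerSeq (p : ℕ) (D : FusionDatum S) : Prop where
  A_eq : ∀ (Q : Subgroup S) (hQ : Q ∈ D.seq), D.A Q hQ = D.fusionSystem.aut Q
  isCentric : ∀ Q ∈ D.seq, D.fusionSystem.IsCentric Q
  sylow : ∀ (Q : Subgroup S) (hQ : Q ∈ D.seq), IsSylowOf p (autS Q) (D.A Q hQ)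
  stronglyEmbedded : ∀ (Q : Subgroup S) (hQ : Q ∈ D.seq), Q ≠ ⊤ →
    HasStronglyEmbedded p (Out (D.A Q hQ))

/-- `D` is an Alperin sequence associated to `F` (a notion for saturated `F`). -/
structure IsAlperinSeq (p : ℕ) (D : FusionDatum S) (F : FusionSystem S) : Prop where
  essential_or_top : ∀ Q ∈ D.seq, F.IsEssential p Q ∨ Q = ⊤
  exists_rep : ∀ E : Subgroup S, F.IsEssential p E →
    ∃ Q ∈ D.seq, F.IsEssential p Q ∧ F.Conj E Q
  A_eq : ∀ (Q : Subgroup S) (hQ : Q ∈ D.seq), D.A Q hQ = F.aut Q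

end FusionDatum

end Fusion

/-! For an `F`-centric `P`, `|N_S(P)| = |Z(P)| |Aut_S(P)|`, and `|Z(P)|` is constant on conjugacy
classes. In a saturated system, fully normalized and fully automized therefore agree on `F`-centric
subgroups, which reconciles the Sylow condition with the definition of essential.

For (1) it remains to see that an essential `E` has a conjugate in the sequence. A strongly
`p`-embedded subgroup of `Out_F(E)` pulls back to a proper `M < Aut_F(E)` that contains every `k`
carrying some noninner element of `Aut_S(E)` into `Aut_S(E)`. The morphisms of `F` that act on
conjugates of `E` only through `M` form a fusion system. If no member `Q` is conjugate to `E`, this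
system contains every `A(Q)`: a conjugate `E₀ ≤ Q` of `E` is proper in `Q`, so it is normalized by
some `g ∈ Q \ E₀`, and `a ∈ A(Q)` turns conjugation by `g` into conjugation by `a(g)`. By minimality
the system is all of `F(D)`, so `Aut_F(E) ≤ M`, a contradiction.

For (2) the content is Alperin's fusion theorem, by downward induction on `|P|`. If all larger
domains are settled and `Q` is a fully automized, receptive conjugate of `P`, then up to `Aut_F(Q)`
every isomorphism onto `Q` extends to a larger group. If `Aut_F(Q)` were not generated, the
generated part would give a strongly `p`-embedded subgroup and `Q` would be essential. -/

namespace Fusion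

/-! ### Strongly `p`-embedded subgroups as control of conjugation in a Sylow subgroup. -/

section StronglyEmbedded

/-- A form of Sylow's second theorem: a `p`-subgroup is conjugate into any Sylow `p`-subgroup. -/
theorem exists_conj_mem_sylow {p : ℕ} [Fact p.Prime] {H : Type*} [Group H] [Finite H]
    (T : Sylow p H) {B : Subgroup H} (hB : IsPGroup p B) : ∃ h : H, ∀ b ∈ B, h * b * h⁻¹ ∈ T := by
  obtain ⟨V, hV⟩ := hB.exists_le_sylow
  obtain ⟨h, rfl⟩ := MulAction.exists_smul_eq H V T
  refine ⟨h, fun b hb => ?_⟩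
  change h * b * h⁻¹ ∈ ((h • V : Sylow p H) : Subgroup H)
  rw [Sylow.coe_subgroup_smul]
  exact Subgroup.smul_mem_pointwise_smul b (MulAut.conj h) _ (hV hb)

theorem isPGroup_zpowers {p : ℕ} {H : Type*} [Group H] {x : H} {n : ℕ} (hx : x ^ p ^ n = 1) :
    IsPGroup p (Subgroup.zpowers x) := by
  rintro ⟨_, k, rfl⟩
  refine ⟨n, Subtype.ext ?_⟩
  change (x ^ k) ^ p ^ n = 1
  rw [← zpow_natCast, zpow_comm, zpow_natCast, hx, one_zpow]

theorem IsSylowOf.exists_conj_mem {p : ℕ} [Fact p.Prime] {G : Type*} [Group G] [Finite G]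
    {T A B : Subgroup G} (h : IsSylowOf p T A) (hBA : B ≤ A) (hB : IsPGroup p B) :
    ∃ a ∈ A, ∀ b ∈ B, a * b * a⁻¹ ∈ T := by
  obtain ⟨U, rfl⟩ := h
  obtain ⟨a, ha⟩ := exists_conj_mem_sylow U (B := B.subgroupOf A)
    (hB.comap_of_injective A.subtype A.subtype_injective)
  exact ⟨a, a.2, fun b hb => ⟨_, ha ⟨b, hBA hb⟩ hb, rfl⟩⟩

/-- A `p`-subgroup of maximal possible order is a Sylow subgroup. -/
theorem isSylowOf_of_card {p : ℕ} [Fact p.Prime] {G : Type*} [Group G] [Finite G]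
    {T A : Subgroup G} (hTA : T ≤ A) (hT : IsPGroup p T)
    (hc : p ^ (Nat.card A).factorization p ≤ Nat.card T) : IsSylowOf p T A := by
  obtain ⟨V, hV⟩ := (hT.comap_of_injective A.subtype A.subtype_injective).exists_le_sylow
  refine ⟨V, ?_⟩
  symm
  refine Subgroup.eq_of_le_of_card_ge (fun x hx => ⟨⟨x, hTA hx⟩, hV hx, rfl⟩) ?_
  rwa [Subgroup.card_map_of_injective A.subtype_injective, V.card_eq_multiplicity]

theorem IsSylowOf.card {p : ℕ} [Fact p.Prime] {G : Type*} [Group G] [Finite G]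
    {T A : Subgroup G} (h : IsSylowOf p T A) :
    Nat.card T = p ^ (Nat.card A).factorization p := by
  obtain ⟨U, rfl⟩ := h
  rw [Subgroup.card_map_of_injective A.subtype_injective, U.card_eq_multiplicity]

theorem dvd_card_of_mem_of_isPGroup {p : ℕ} [Fact p.Prime] {H : Type*} [Group H] [Finite H]
    {T M : Subgroup H} (hT : IsPGroup p T) {x : H} (hxT : x ∈ T) (hx : x ≠ 1) (hxM : x ∈ M) :
    p ∣ Nat.card M := by
  have h1 : p ∣ orderOf x := by
    obtain ⟨k, hk⟩ := (IsPGroup.iff_orderOf.mp hT) ⟨x, hxT⟩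
    rw [Subgroup.orderOf_mk] at hk
    rw [hk]
    refine dvd_pow_self p ?_
    rintro rfl
    exact hx (orderOf_eq_one_iff.mp (by simpa using hk))
  exact h1.trans (Subgroup.orderOf_dvd_natCard M hxM)

/-- If `H` has a strongly `p`-embedded subgroup, then it has one which contains a given Sylow
`p`-subgroup `T` and controls the conjugation of nontrivial elements of `T`. -/
theorem HasStronglyEmbedded.exists_sylow_le {p : ℕ} [Fact p.Prime] {H : Type*} [Group H]
    [Finite H] (h : HasStronglyEmbedded p H) (T : Sylow p H) :
    ∃ M : Subgroup H, M ≠ ⊤ ∧ (T : Subgroup H) ≤ M ∧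
      ∀ h : H, ∀ y ∈ T, y ≠ 1 → h * y * h⁻¹ ∈ T → h ∈ M := by
  obtain ⟨L, hL, hpL, hLc⟩ := h
  -- A nontrivial `p`-element in `L ∩ hLh⁻¹` forces `h ∈ L`.
  have key : ∀ h x : H, x ∈ L → h⁻¹ * x * h ∈ L → (∃ n, x ^ p ^ n = 1) → x ≠ 1 → h ∈ L := by
    rintro h x hx hx' ⟨n, hn⟩ h1
    by_contra hh
    refine hLc h hh (dvd_card_of_mem_of_isPGroup (isPGroup_zpowers hn)
      (Subgroup.mem_zpowers x) h1 ⟨hx, h⁻¹ * x * h, hx', ?_⟩)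
    simp [mul_assoc]
  obtain ⟨x, hx⟩ := exists_prime_orderOf_dvd_card' (G := L) p hpL
  have hxp : (x : H) ^ p ^ 1 = 1 := by
    rw [pow_one, ← Subgroup.orderOf_coe x] at *
    rw [← hx, pow_orderOf_eq_one]
  have hx1 : (x : H) ≠ 1 := by
    intro h
    rw [← Subgroup.orderOf_coe, h, orderOf_one] at hx
    exact (Fact.out : p.Prime).one_lt.ne hx
  obtain ⟨g, hg⟩ := exists_conj_mem_sylow T (isPGroup_zpowers hxp)
  have hgx := hg x (Subgroup.mem_zpowers _)
  have hTn : ∀ y ∈ T, ∃ n, y ^ p ^ n = 1 := fun y hy => by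
    obtain ⟨n, hn⟩ := T.isPGroup' ⟨y, hy⟩
    exact ⟨n, by simpa using congrArg Subtype.val hn⟩
  set x' : H := g * x * g⁻¹ with hx'
  have hx'1 : x' ≠ 1 := by
    intro h
    exact hx1 (by simpa [hx'] using h)
  -- The conjugate `gLg⁻¹`, chosen to contain the nontrivial element `x'` of `T`.
  let M : Subgroup H := L.comap (MulAut.conj g⁻¹).toMonoidHom
  have hM : ∀ y, y ∈ M ↔ g⁻¹ * y * g ∈ L := fun y => by simp [M]
  have keyM : ∀ h y : H, y ∈ M → h⁻¹ * y * h ∈ M → (∃ n, y ^ p ^ n = 1) → y ≠ 1 → h ∈ M := by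
    rintro h y hy hy' ⟨n, hn⟩ h1
    rw [hM] at *
    refine key _ _ hy ?_ ⟨n, ?_⟩ ?_
    · simpa [mul_assoc] using hy'
    · have := conj_pow (i := p ^ n) (a := g⁻¹) (b := y)
      rw [inv_inv] at this
      rw [this, hn]; simp
    · intro h
      apply h1
      have : y = g * (g⁻¹ * y * g) * g⁻¹ := by group
      rw [this, h]; simp
  have hx'M : x' ∈ M := by rw [hM]; simp [hx', mul_assoc]
  have : Nontrivial T := ⟨⟨⟨x', hgx⟩, 1, fun h => hx'1 (congrArg Subtype.val h)⟩⟩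
  have := T.isPGroup'.center_nontrivial
  -- A central `z` links `x'` to all of `T`: `z` commutes with `x' ∈ M`, hence lies in `M`; then
  -- each `t ∈ T` commutes with `z ∈ M`, hence lies in `M`.
  obtain ⟨⟨z, hz⟩, hz1⟩ := exists_ne (1 : Subgroup.center T)
  have hzc : ∀ t ∈ T, t * (z : H) = z * t := fun t ht =>
    congrArg Subtype.val (Subgroup.mem_center_iff.mp hz ⟨t, ht⟩)
  have hz1' : (z : H) ≠ 1 := fun h => hz1 (Subtype.ext (Subtype.ext h))
  have hzM : (z : H) ∈ M := by
    refine keyM z x' hx'M ?_ (hTn _ hgx) hx'1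
    rw [mul_assoc, hzc _ hgx]; simpa using hx'M
  have hTM : (T : Subgroup H) ≤ M := by
    intro t ht
    refine keyM t z hzM ?_ (hTn _ z.2) hz1'
    rw [mul_assoc, ← hzc _ ht]; simpa using hzM
  refine ⟨M, ?_, hTM, ?_⟩
  · intro h
    refine hL (Subgroup.eq_top_iff' L |>.mpr fun y => ?_)
    have : g * y * g⁻¹ ∈ M := h ▸ Subgroup.mem_top _
    rw [hM] at this
    simpa [mul_assoc] using this
  · intro h y hy hy1 hhy
    have := keyM h⁻¹ y (hTM hy) (by simpa using hTM hhy) (hTn y hy) hy1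
    simpa using this

/-- A proper subgroup containing a nontrivial Sylow `p`-subgroup `T` and controlling the
conjugation of nontrivial elements of `T` is strongly `p`-embedded. -/
theorem hasStronglyEmbedded_of_sylow_le {p : ℕ} [Fact p.Prime] {H : Type*} [Group H]
    [Finite H] (T : Sylow p H) (hT : (T : Subgroup H) ≠ ⊥) {M : Subgroup H} (hM : M ≠ ⊤)
    (hTM : (T : Subgroup H) ≤ M) (hc : ∀ h : H, ∀ y ∈ T, y ≠ 1 → h * y * h⁻¹ ∈ T → h ∈ M) :
    HasStronglyEmbedded p H := by
  have conj_mem : ∀ x ∈ M, x ^ p ^ 1 = 1 → ∃ m ∈ M, m * x * m⁻¹ ∈ T := by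
    intro x hx hxp
    have hxp' : (⟨x, hx⟩ : M) ^ p ^ 1 = 1 := Subtype.ext (by simpa using hxp)
    obtain ⟨m, hm⟩ := exists_conj_mem_sylow (T.subtype hTM) (isPGroup_zpowers hxp')
    exact ⟨m, m.2, hm _ (Subgroup.mem_zpowers _)⟩
  obtain ⟨⟨t, ht⟩, ht1⟩ := Subgroup.ne_bot_iff_exists_ne_one.mp hT
  refine ⟨M, hM, dvd_card_of_mem_of_isPGroup T.isPGroup' ht (by simpa using ht1) (hTM ht), ?_⟩
  intro h hh hdvd
  obtain ⟨⟨x, hxm⟩, hx⟩ := exists_prime_orderOf_dvd_card' p hdvd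
  rw [Subgroup.orderOf_mk] at hx
  obtain ⟨hxM, y, hyM, hyx⟩ := hxm
  have hyx' : h * y * h⁻¹ = x := hyx
  have hx1 : x ≠ 1 := by
    rintro rfl
    rw [orderOf_one] at hx
    exact (Fact.out : p.Prime).one_lt.ne hx
  have hxp : x ^ p ^ 1 = 1 := by rw [pow_one, ← hx, pow_orderOf_eq_one]
  have hy : y = h⁻¹ * x * h := by rw [← hyx']; group
  have hyp : y ^ p ^ 1 = 1 := by
    have := conj_pow (i := p ^ 1) (a := h⁻¹) (b := x)
    rw [inv_inv] at this
    rw [hy, this, hxp]; simp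
  obtain ⟨m, hm, hmx⟩ := conj_mem x hxM hxp
  obtain ⟨m', hm', hmy⟩ := conj_mem y hyM hyp
  -- Since `y = h⁻¹xh`, this element carries `mxm⁻¹ ∈ T` to `m'ym'⁻¹ ∈ T`.
  have hk := hc (m' * h⁻¹ * m⁻¹) _ hmx (by simpa using hx1)
    (by rw [hy] at hmy; simpa [mul_assoc] using hmy)
  apply hh
  have : h = (m'⁻¹ * (m' * h⁻¹ * m⁻¹) * m)⁻¹ := by group
  rw [this]
  exact M.inv_mem (M.mul_mem (M.mul_mem (M.inv_mem hm') hk) hm)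

/-- Lifts the condition on `Out` to `Aut_F(E)` itself: "nontrivial" in the quotient becomes "not in
`N`", and later arguments need no cosets. -/
theorem exists_control_of_hasStronglyEmbedded_quotient {p : ℕ} [Fact p.Prime] {K : Type*}
    [Group K] [Finite K] (N : Subgroup K) [N.Normal] (T : Sylow p K)
    (h : HasStronglyEmbedded p (K ⧸ N)) :
    ∃ M : Subgroup K, M ≠ ⊤ ∧ ∀ k : K, ∀ y ∈ T, y ∉ N → k * y * k⁻¹ ∈ T → k ∈ M := by
  have hs := QuotientGroup.mk'_surjective N
  obtain ⟨M, hM, -, hc⟩ := h.exists_sylow_le (T.mapSurjective hs)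
  refine ⟨M.comap (QuotientGroup.mk' N), fun h => hM ?_, fun k y hy hyN hky => ?_⟩
  · rw [← Subgroup.map_comap_eq_self_of_surjective hs M, h,
      Subgroup.map_top_of_surjective _ hs]
  · exact hc _ (QuotientGroup.mk' N y) ⟨y, hy, rfl⟩
      (fun h => hyN ((QuotientGroup.eq_one_iff y).mp h)) ⟨_, hky, by simp⟩

/-- The strict inclusion `N < T` keeps the image of `T` nontrivial, so that `p` divides the order of
the image of `M`. -/
theorem hasStronglyEmbedded_quotient_of_control {p : ℕ} [Fact p.Prime] {K : Type*}
    [Group K] [Finite K] (N : Subgroup K) [N.Normal] (T : Sylow p K) {M : Subgroup K}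
    (hNT : N < T) (hTM : (T : Subgroup K) ≤ M) (hM : M ≠ ⊤)
    (hc : ∀ k : K, ∀ y ∈ T, y ∉ N → k * y * k⁻¹ ∈ T → k ∈ M) :
    HasStronglyEmbedded p (K ⧸ N) := by
  have hs := QuotientGroup.mk'_surjective N
  have mem_of_mk : ∀ L : Subgroup K, N ≤ L → ∀ k : K,
      QuotientGroup.mk' N k ∈ L.map (QuotientGroup.mk' N) → k ∈ L := by
    rintro L hL k ⟨l, hl, hlk⟩
    have := L.mul_mem hl (hL (QuotientGroup.eq.mp hlk))
    simpa using this
  refine hasStronglyEmbedded_of_sylow_le (T.mapSurjective hs) ?_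
    (M := M.map (QuotientGroup.mk' N)) ?_ (Subgroup.map_mono hTM) ?_
  · rw [Sylow.coe_mapSurjective, Ne, Subgroup.map_eq_bot_iff, QuotientGroup.ker_mk']
    exact hNT.not_ge
  · intro h
    refine hM ((Subgroup.eq_top_iff' M).mpr fun k => ?_)
    exact mem_of_mk M (hNT.le.trans hTM) k (h ▸ Subgroup.mem_top _)
  · intro h y hy hy1 hhy
    obtain ⟨k, rfl⟩ := hs h
    obtain ⟨t, ht, rfl⟩ := hy
    refine ⟨k, hc k t ht (fun h => hy1 ((QuotientGroup.eq_one_iff t).mpr h)) ?_, rfl⟩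
    exact mem_of_mk T hNT.le _ hhy

end StronglyEmbedded

/-! ### Automorphisms induced by `S`, and centric subgroups. -/

variable {S : Type*} [Group S]

/-- The automorphisms `a` of `G` which an embedding `ψ` of `G` into `S` turns into conjugation by
an element of `S`. -/
def autVia {G : Type*} [Group G] (ψ : G →* S) : Subgroup (MulAut G) where
  carrier := {a | ∃ g : S, ∀ x, ψ (a x) = g * ψ x * g⁻¹}
  one_mem' := ⟨1, fun x => by simp⟩
  mul_mem' := by
    rintro a b ⟨g, hg⟩ ⟨h, hh⟩
    exact ⟨g * h, fun x => by rw [MulAut.mul_apply, hg, hh]; group⟩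
  inv_mem' := by
    rintro a ⟨g, hg⟩
    refine ⟨g⁻¹, fun x => ?_⟩
    have := hg (a⁻¹ x)
    rw [MulAut.apply_inv_self] at this
    rw [this]; group

theorem isPGroup_autVia {p : ℕ} (hS : IsPGroup p S) {G : Type*} [Group G] {ψ : G →* S}
    (hψ : Function.Injective ψ) : IsPGroup p (autVia ψ) := by
  rintro ⟨a, g, hg⟩
  obtain ⟨n, hn⟩ := hS g
  refine ⟨n, Subtype.ext ?_⟩
  have key : ∀ k : ℕ, ∀ x, ψ ((a ^ k) x) = g ^ k * ψ x * (g ^ k)⁻¹ := by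
    intro k
    induction k with
    | zero => simp
    | succ k ih =>
      intro x
      rw [pow_succ', MulAut.mul_apply, hg, ih, pow_succ']; group
  ext x
  change (a ^ p ^ n) x = x
  apply hψ
  rw [key, hn]; simp

theorem mem_autS_iff {P : Subgroup S} {a : MulAut P} :
    a ∈ autS P ↔ ∃ g : S, ∀ x : P, (a x : S) = g * x * g⁻¹ := by
  constructor
  · rintro ⟨g, rfl⟩
    exact ⟨g, fun x => rfl⟩
  · rintro ⟨g, hg⟩
    have hgN : g ∈ Subgroup.normalizer (P : Set S) := by
      rw [Subgroup.mem_normalizer_iff]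
      refine fun x => ⟨fun hx => hg ⟨x, hx⟩ ▸ (a ⟨x, hx⟩).2, fun hx => ?_⟩
      have h := hg (a.symm ⟨_, hx⟩)
      rw [MulEquiv.apply_symm_apply] at h
      have : x = (a.symm ⟨_, hx⟩ : P) := by simpa using h
      rw [this]
      exact Subtype.prop _
    refine ⟨⟨g, hgN⟩, ?_⟩
    ext x
    exact (hg x).symm

theorem autS_eq_autVia (P : Subgroup S) : autS P = autVia P.subtype := by
  ext a
  exact mem_autS_iff

theorem isPGroup_autS {p : ℕ} (hS : IsPGroup p S) (P : Subgroup S) : IsPGroup p (autS P) := by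
  rw [autS_eq_autVia]
  exact isPGroup_autVia hS P.subtype_injective

theorem inn_le_autS (P : Subgroup S) : inn P ≤ autS P := by
  rintro _ ⟨g, rfl⟩
  exact mem_autS_iff.mpr ⟨g, fun x => rfl⟩

theorem centralizer_le_normalizer (P : Subgroup S) :
    Subgroup.centralizer (P : Set S) ≤ Subgroup.normalizer (P : Set S) := by
  intro c hc
  rw [Subgroup.mem_centralizer_iff] at hc
  rw [Subgroup.mem_normalizer_iff]
  refine fun x => ⟨fun hx => ?_, fun hx => ?_⟩
  · rwa [← hc x hx, mul_inv_cancel_right]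
  · have h := hc _ hx
    have : x = c * x * c⁻¹ := by
      have h2 : c * x * c⁻¹ * c = c * (c * x * c⁻¹) := h
      rw [inv_mul_cancel_right] at h2
      exact mul_left_cancel h2
    rwa [this]

theorem isCentricIn_iff {P : Subgroup S} :
    IsCentricIn P ↔ Subgroup.centralizer (P : Set S) ≤ P := by
  constructor
  · intro h c hc
    rw [IsCentricIn] at h
    rw [h] at hc
    exact Subgroup.map_subtype_le _ hc
  · intro h
    apply le_antisymm
    · intro c hc
      refine ⟨⟨c, h hc⟩, ?_, rfl⟩
      refine Subgroup.mem_center_iff.mpr fun x => Subtype.ext ?_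
      exact Subgroup.mem_centralizer_iff.mp hc x x.2
    · rintro _ ⟨c, hc, rfl⟩
      refine Subgroup.mem_centralizer_iff.mpr fun x hx => ?_
      exact congrArg Subtype.val (Subgroup.mem_center_iff.mp hc ⟨x, hx⟩)

theorem isCentricIn_top : IsCentricIn (⊤ : Subgroup S) := isCentricIn_iff.mpr le_top

/-- If `P` is `S`-centric, an element of `S` inducing an inner automorphism of `P` lies in `P`. -/
theorem IsCentricIn.mem_of_mem_inn {P : Subgroup S} (hP : IsCentricIn P) {a : MulAut P}
    (ha : a ∈ inn P) {g : S} (hg : ∀ x : P, (a x : S) = g * x * g⁻¹) : g ∈ P := by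
  obtain ⟨y, rfl⟩ := ha
  have hc : (y : S)⁻¹ * g ∈ P := by
    refine isCentricIn_iff.mp hP (Subgroup.mem_centralizer_iff.mpr fun x hx => ?_)
    have h : (y : S) * x * (y : S)⁻¹ = g * x * g⁻¹ := hg ⟨x, hx⟩
    have h2 : g * x = y * x * (y : S)⁻¹ * g := by rw [h]; group
    rw [mul_assoc, h2]; group
  simpa using P.mul_mem y.2 hc

/-- The kernel of `N_S(P) → Aut(P)` is `C_S(P) = Z(P)`. -/
theorem IsCentricIn.card_normalizer {P : Subgroup S} (hP : IsCentricIn P) :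
    Nat.card (Subgroup.normalizer (P : Set S)) =
      Nat.card (Subgroup.center P) * Nat.card (autS P) := by
  have h := Subgroup.card_mul_index P.normalizerMonoidHom.ker
  rw [Subgroup.index_ker, Subgroup.normalizerMonoidHom_ker] at h
  rw [← h]
  congr 1
  rw [Nat.card_congr (Subgroup.subgroupOfEquivOfLe (centralizer_le_normalizer P)).toEquiv]
  rw [IsCentricIn] at hP
  rw [hP, Subgroup.card_map_of_injective P.subtype_injective]

/-! ### Calculus of morphisms, conjugacy classes, fully normalized versus fully automized. -/

namespace FusionSystem

variable (F : FusionSystem S)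

theorem inclusion_mem {P Q : Subgroup S} (h : P ≤ Q) : Subgroup.inclusion h ∈ F.hom P Q :=
  F.homS_subset _ _ ⟨1, fun x => by simp⟩

variable {F}

/-- Membership in a fusion system is stable under restriction and change of codomain. -/
theorem mem_of_agree {P Q P' Q' : Subgroup S} {φ : P →* Q} (hφ : φ ∈ F.hom P Q) (hP : P' ≤ P)
    {ψ : P' →* Q'} (h : ∀ x : P', (ψ x : S) = φ (Subgroup.inclusion hP x)) :
    ψ ∈ F.hom P' Q' := by
  obtain ⟨e, he, hem, -⟩ := F.factor (F.comp_mem (F.inclusion_mem hP) hφ)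
  have hle : image (φ.comp (Subgroup.inclusion hP)) ≤ Q' := by
    rintro _ ⟨x, rfl⟩
    change (φ (Subgroup.inclusion hP x) : S) ∈ Q'
    rw [← h]
    exact (ψ x).2
  convert F.comp_mem hem (F.inclusion_mem hle) using 1
  ext x
  change (ψ x : S) = e x
  rw [he, h]
  rfl

theorem symm_mem_hom {P Q : Subgroup S} {α : P ≃* Q} (hα : α.toMonoidHom ∈ F.hom P Q) :
    α.symm.toMonoidHom ∈ F.hom Q P := by
  obtain ⟨e, he, -, hs⟩ := F.factor hα
  have hle : Q ≤ image α.toMonoidHom := fun x hx => ⟨α.symm ⟨x, hx⟩, by simp⟩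
  refine mem_of_agree hs hle fun x => congrArg Subtype.val ?_
  change α.symm x = e.symm (Subgroup.inclusion hle x)
  rw [eq_comm, MulEquiv.symm_apply_eq]
  apply Subtype.ext
  rw [he]
  exact congrArg Subtype.val (α.apply_symm_apply x).symm

theorem trans_mem {P Q R : Subgroup S} {α : P ≃* Q} {β : Q ≃* R}
    (hα : α.toMonoidHom ∈ F.hom P Q) (hβ : β.toMonoidHom ∈ F.hom Q R) :
    (α.trans β).toMonoidHom ∈ F.hom P R := F.comp_mem hα hβ

/-- Cancel `ψ` by the inverse of its isomorphism onto its image. -/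
theorem mem_of_comp_mem {E E' P : Subgroup S} {a : E' →* E} {ψ : E →* P}
    (hψ : ψ ∈ F.hom E P) (h : ψ.comp a ∈ F.hom E' P) : a ∈ F.hom E' E := by
  obtain ⟨e, he, hem, hs⟩ := F.factor hψ
  have h2 : e.toMonoidHom.comp a ∈ F.hom E' (image ψ) :=
    mem_of_agree h le_rfl fun x => he (a x)
  convert F.comp_mem h2 hs using 1
  ext x
  simp

theorem conj_comp_mem {E P R : Subgroup S} {ψ : E →* P} (hψ : ψ ∈ F.hom E P) {χ : E →* R}
    (g : S) (h : ∀ x, (χ x : S) = g * ψ x * g⁻¹) : χ ∈ F.hom E R := by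
  let c : P →* (⊤ : Subgroup S) :=
    ((MulAut.conj g).toMonoidHom.comp P.subtype).codRestrict ⊤ fun _ => Subgroup.mem_top _
  have hc : c ∈ F.hom P ⊤ := F.homS_subset _ _ ⟨g, fun x => rfl⟩
  exact mem_of_agree (F.comp_mem hψ hc) le_rfl h

theorem autVia_le_aut {E P : Subgroup S} {ψ : E →* P} (hψ : ψ ∈ F.hom E P) :
    autVia (P.subtype.comp ψ) ≤ F.aut E := by
  rintro a ⟨g, hg⟩
  exact mem_of_comp_mem hψ (conj_comp_mem hψ g hg)

theorem autS_le_aut (P : Subgroup S) : autS P ≤ F.aut P := by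
  rw [autS_eq_autVia]
  exact autVia_le_aut (F.refl_mem P)

theorem subtype_comp_injective {E P : Subgroup S} {ψ : E →* P} (hψ : ψ ∈ F.hom E P) :
    Function.Injective (P.subtype.comp ψ) :=
  P.subtype_injective.comp (F.injective hψ)

theorem Conj.exists_equiv {P Q : Subgroup S} (h : F.Conj P Q) :
    ∃ α : P ≃* Q, α.toMonoidHom ∈ F.hom P Q := by
  obtain ⟨φ, hφ, rfl⟩ := h
  obtain ⟨e, -, he, -⟩ := F.factor hφ
  exact ⟨e, he⟩

theorem conj_of_equiv {P Q : Subgroup S} {α : P ≃* Q} (h : α.toMonoidHom ∈ F.hom P Q) :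
    F.Conj P Q := by
  refine ⟨_, F.comp_mem h (F.inclusion_mem le_top), ?_⟩
  ext x
  constructor
  · rintro ⟨y, rfl⟩
    exact (α y).2
  · intro hx
    exact ⟨α.symm ⟨x, hx⟩, by simp⟩

theorem Conj.refl (P : Subgroup S) : F.Conj P P :=
  conj_of_equiv (α := MulEquiv.refl P) (F.refl_mem P)

theorem Conj.symm {P Q : Subgroup S} (h : F.Conj P Q) : F.Conj Q P := by
  obtain ⟨α, hα⟩ := h.exists_equiv
  exact conj_of_equiv (symm_mem_hom hα)

theorem Conj.trans {P Q R : Subgroup S} (h : F.Conj P Q) (h' : F.Conj Q R) : F.Conj P R := by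
  obtain ⟨α, hα⟩ := h.exists_equiv
  obtain ⟨β, hβ⟩ := h'.exists_equiv
  exact conj_of_equiv (trans_mem hα hβ)

theorem Conj.card_eq {P Q : Subgroup S} (h : F.Conj P Q) : Nat.card P = Nat.card Q := by
  obtain ⟨α, -⟩ := h.exists_equiv
  exact Nat.card_congr α.toEquiv

theorem Conj.eq_top [Finite S] {Q : Subgroup S} (h : F.Conj ⊤ Q) : Q = ⊤ :=
  Subgroup.eq_top_of_card_eq Q (by rw [← h.card_eq, Subgroup.card_top])

theorem isCentric_top [Finite S] : F.IsCentric ⊤ := by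
  intro Q hQ
  rw [hQ.eq_top]
  exact isCentricIn_top

theorem card_aut_eq {P Q : Subgroup S} (h : F.Conj P Q) :
    Nat.card (F.aut P) = Nat.card (F.aut Q) := by
  obtain ⟨α, hα⟩ := h.exists_equiv
  refine Nat.card_congr ((MulAut.congr α).toEquiv.subtypeEquiv fun a => ⟨fun ha => ?_, fun ha => ?_⟩)
  · exact F.comp_mem (F.comp_mem (symm_mem_hom hα) ha) hα
  · have h2 := F.comp_mem (F.comp_mem hα ha) (symm_mem_hom hα)
    have h3 : a.toMonoidHom = α.symm.toMonoidHom.comp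
        ((MulEquiv.toMonoidHom ((MulAut.congr α).toEquiv a)).comp α.toMonoidHom) := by
      ext x
      simp [MulAut.congr]
    change a.toMonoidHom ∈ F.hom P P
    rw [h3]
    exact h2

/-- `Aut_S(P)` is a `p`-subgroup of a group of the same order as `Aut_F(Q)`, in which `Aut_S(Q)` is
Sylow. -/
theorem card_autS_le {p : ℕ} [Fact p.Prime] [Finite S] (hS : IsPGroup p S) {P Q : Subgroup S}
    (h : F.Conj P Q) (hQ : F.IsFullyAutomized p Q) : Nat.card (autS P) ≤ Nat.card (autS Q) := by
  rw [IsSylowOf.card hQ, ← card_aut_eq h]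
  obtain ⟨n, hn⟩ := IsPGroup.iff_card.mp (isPGroup_autS hS P)
  rw [hn]
  refine Nat.pow_le_pow_right (Fact.out : p.Prime).pos ?_
  rw [← (Fact.out : p.Prime).pow_dvd_iff_le_factorization Nat.card_pos.ne', ← hn]
  exact Subgroup.card_dvd_of_le (autS_le_aut P)

theorem Conj.card_center_eq {P Q : Subgroup S} (h : F.Conj P Q) :
    Nat.card (Subgroup.center P) = Nat.card (Subgroup.center Q) := by
  obtain ⟨α, -⟩ := h.exists_equiv
  exact Nat.card_congr (Subgroup.centerCongr α).toEquiv

theorem IsCentric.isCentricIn {P : Subgroup S} (h : F.IsCentric P) : IsCentricIn P :=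
  h P (Conj.refl P)

theorem IsFullyAutomized.isFullyNormalized {p : ℕ} [Fact p.Prime] [Finite S] (hS : IsPGroup p S)
    {P : Subgroup S} (h : F.IsFullyAutomized p P) (hc : F.IsCentric P) :
    F.IsFullyNormalized P := by
  intro Q hQ
  rw [(hc Q hQ).card_normalizer, hc.isCentricIn.card_normalizer, hQ.card_center_eq]
  exact Nat.mul_le_mul_left _ (card_autS_le hS hQ.symm h)

/-- Saturation supplies a fully automized conjugate `Q`; comparing normalizers gives `|Aut_S(P)| ≥
|Aut_S(Q)|`, the full `p`-part. -/
theorem IsFullyNormalized.isFullyAutomized {p : ℕ} [Fact p.Prime] [Finite S] (hS : IsPGroup p S)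
    (hF : F.IsSaturated p) {P : Subgroup S} (h : F.IsFullyNormalized P) (hc : F.IsCentric P) :
    F.IsFullyAutomized p P := by
  obtain ⟨Q, hQ, hQA, -⟩ := hF P
  refine isSylowOf_of_card (autS_le_aut P) (isPGroup_autS hS P) ?_
  have hN := h Q hQ
  rw [(hc Q hQ).card_normalizer, hc.isCentricIn.card_normalizer, hQ.card_center_eq] at hN
  rw [card_aut_eq hQ, ← IsSylowOf.card hQA]
  exact Nat.le_of_mul_le_mul_left hN Nat.card_pos

end FusionSystem

/-- Normalizers grow in the nilpotent group `Q`. -/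
theorem exists_mem_normalizer_notMem {p : ℕ} [Fact p.Prime] [Finite S] (hS : IsPGroup p S)
    {P Q : Subgroup S} (h : P < Q) :
    ∃ g ∈ Q, g ∈ Subgroup.normalizer (P : Set S) ∧ g ∉ P := by
  have hn : Group.IsNilpotent Q := (hS.to_subgroup Q).isNilpotent
  have hlt := Group.normalizerCondition_of_isNilpotent (G := Q) (P.subgroupOf Q)
    (lt_top_iff_ne_top.mpr fun h' => h.not_ge (Subgroup.subgroupOf_eq_top.mp h'))
  obtain ⟨⟨g, hgQ⟩, hg, hgP⟩ := SetLike.exists_of_lt hlt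
  refine ⟨g, hgQ, ?_, hgP⟩
  rw [Subgroup.mem_normalizer_iff] at hg ⊢
  intro x
  by_cases hx : x ∈ Q
  · exact hg ⟨x, hx⟩
  · refine ⟨fun hx' => (hx (h.le hx')).elim, fun hx' => (hx ?_).elim⟩
    have := Q.mul_mem (Q.mul_mem (Q.inv_mem hgQ) (h.le hx')) hgQ
    simpa [mul_assoc] using this

/-! ### Adapted morphisms and the subsystem controlled by `M`. -/

namespace FusionSystem

variable {F : FusionSystem S}

theorem conj_image {E P : Subgroup S} {ψ : E →* P} (hψ : ψ ∈ F.hom E P) :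
    F.Conj E (image ψ) := by
  obtain ⟨e, -, he, -⟩ := F.factor hψ
  exact conj_of_equiv he

theorem image_le {E P : Subgroup S} (ψ : E →* P) : image ψ ≤ P := by
  rintro _ ⟨x, rfl⟩
  exact (ψ x).2

/-- A morphism `ψ` out of `E` is adapted if pulling back along `ψ` maps `Aut_S(ψ(E))` into
`Aut_S(E)`. -/
def IsAdapted {E P : Subgroup S} (ψ : E →* P) : Prop :=
  autVia (P.subtype.comp ψ) ≤ autS E

theorem isAdapted_id (E : Subgroup S) : IsAdapted (MonoidHom.id E) := (autS_eq_autVia E).ge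

/-- By Sylow, some `m` conjugates the `p`-group pulled back along `ψ` into `Aut_S(E)`; then `χ = ψ ∘
m⁻¹` is adapted. -/
theorem IsFullyAutomized.exists_isAdapted {p : ℕ} [Fact p.Prime] [Finite S] (hS : IsPGroup p S)
    {E P : Subgroup S} (hE : F.IsFullyAutomized p E) {ψ : E →* P} (hψ : ψ ∈ F.hom E P) :
    ∃ m ∈ F.aut E, ∃ χ ∈ F.hom E P, IsAdapted χ ∧ ∀ x, χ (m x) = ψ x := by
  obtain ⟨m, hm, hmT⟩ := IsSylowOf.exists_conj_mem hE (autVia_le_aut hψ)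
    (isPGroup_autVia hS (subtype_comp_injective hψ))
  refine ⟨m, hm, ψ.comp m.symm.toMonoidHom, F.comp_mem (F.symm_mem hm) hψ, ?_, fun x => by simp⟩
  rintro a ⟨g, hg⟩
  have h := hmT (m⁻¹ * a * m) ⟨g, fun x => ?_⟩
  · simpa [mul_assoc] using h
  · have := hg (m x)
    simpa using this

theorem exists_control {p : ℕ} [Fact p.Prime] [Finite S] {E : Subgroup S}
    (hE : F.IsFullyAutomized p E) (h : HasStronglyEmbedded p (Out (F.aut E))) :
    ∃ M : Subgroup (MulAut E), ¬ F.aut E ≤ M ∧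
      ∀ k ∈ F.aut E, ∀ y ∈ autS E, y ∉ inn E → k * y * k⁻¹ ∈ autS E → k ∈ M := by
  obtain ⟨U, hU⟩ := hE
  have hmem : ∀ y : F.aut E, (y : MulAut E) ∈ autS E → y ∈ U := by
    rintro y hy
    rw [← hU] at hy
    obtain ⟨z, hz, hzy⟩ := hy
    obtain rfl : z = y := Subtype.ext hzy
    exact hz
  obtain ⟨M, hM, hc⟩ := exists_control_of_hasStronglyEmbedded_quotient _ U h
  refine ⟨M.map (F.aut E).subtype, fun hle => hM ?_, fun k hk y hy hyI hky => ?_⟩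
  · refine (Subgroup.eq_top_iff' M).mpr fun k => ?_
    obtain ⟨z, hz, hzk⟩ := hle k.2
    obtain rfl : z = k := Subtype.ext hzk
    exact hz
  · exact ⟨⟨k, hk⟩, hc ⟨k, hk⟩ ⟨y, autS_le_aut E hy⟩ (hmem _ hy) hyI (hmem _ hky), rfl⟩

/-- A morphism `φ` is controlled by `M ≤ Aut(E)` if, whenever `E` and its image are identified
with `E` along adapted morphisms, `φ` corresponds to an element of `M`. -/
def IsControlled (F : FusionSystem S) (E : Subgroup S) (M : Subgroup (MulAut E))
    {P R : Subgroup S} (φ : P →* R) : Prop :=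
  ∀ ψ ∈ F.hom E P, IsAdapted ψ → ∀ ψ' ∈ F.hom E ⊤, IsAdapted ψ' →
    ∀ m ∈ F.aut E, (∀ x, (φ (ψ x) : S) = ψ' (m x)) → m ∈ M

/-- The fusion system of all `M`-controlled morphisms of `F`. -/
def controlled (F : FusionSystem S) (E : Subgroup S) (M : Subgroup (MulAut E))
    (hE : ∀ {P : Subgroup S} {ψ : E →* P}, ψ ∈ F.hom E P →
      ∃ m ∈ F.aut E, ∃ χ ∈ F.hom E P, IsAdapted χ ∧ ∀ x, χ (m x) = ψ x)
    (hM : ∀ {P R : Subgroup S} {φ : P →* R}, φ ∈ homS P R → F.IsControlled E M φ) :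
    FusionSystem S where
  hom P R := {φ | φ ∈ F.hom P R ∧ F.IsControlled E M φ}
  comp_mem := by
    rintro P Q R φ χ ⟨hφ, hφM⟩ ⟨hχ, hχM⟩
    refine ⟨F.comp_mem hφ hχ, fun ψ hψ hψa ψ' hψ' hψa' m hm hx => ?_⟩
    -- An adapted identification `ξ` at the intermediate stage splits `m` as `(m n⁻¹) n`, one factor
    -- for each morphism.
    obtain ⟨n, hn, ξ, hξ, hξa, hξn⟩ := hE (F.comp_mem hψ hφ)
    have h₁ : n ∈ M := hφM ψ hψ hψa _ (F.comp_mem hξ (F.inclusion_mem le_top)) hξa n hn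
      fun x => congrArg Subtype.val (hξn x).symm
    have h₂ : m * n⁻¹ ∈ M := by
      refine hχM ξ hξ hξa ψ' hψ' hψa' _ (mul_mem hm (inv_mem hn)) fun x => ?_
      have := hx (n⁻¹ x)
      rw [MonoidHom.comp_apply, ← MonoidHom.comp_apply φ, ← hξn, MulAut.apply_inv_self] at this
      exact this
    simpa using mul_mem h₂ h₁
  homS_subset P R φ hφ := ⟨F.homS_subset P R hφ, hM hφ⟩
  injective h := F.injective h.1
  factor := by
    rintro P Q φ ⟨hφ, hφM⟩
    obtain ⟨e, he, hem, hes⟩ := F.factor hφ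
    refine ⟨e, he, ⟨hem, fun ψ hψ hψa ψ' hψ' hψa' m hm hx => ?_⟩,
      ⟨hes, fun ψ hψ hψa ψ' hψ' hψa' m hm hx => ?_⟩⟩
    · exact hφM ψ hψ hψa ψ' hψ' hψa' m hm fun x => by rw [← hx, ← he]; rfl
    -- This map `χ = e⁻¹ψm⁻¹` agrees with `ψ'` in `S`, so it is adapted; from `φχ = ψm⁻¹`, control
    -- of `φ` gives `m⁻¹ ∈ M`.
    · have hχ : (e.symm.toMonoidHom.comp ψ).comp m.symm.toMonoidHom ∈ F.hom E P :=
        F.comp_mem (F.symm_mem hm) (F.comp_mem hψ hes)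
      have hχψ : ∀ x, ((e.symm.toMonoidHom.comp ψ).comp m.symm.toMonoidHom x : S) = ψ' x :=
        fun x => by
          have := hx (m.symm x)
          rw [MulEquiv.apply_symm_apply] at this
          exact this
      have hχa : IsAdapted ((e.symm.toMonoidHom.comp ψ).comp m.symm.toMonoidHom) := by
        rintro a ⟨g, hg⟩
        refine hψa' ⟨g, fun x => ?_⟩
        have h := hg x
        simp only [MonoidHom.comp_apply, Subgroup.subtype_apply] at h hχψ ⊢
        rw [← hχψ, ← hχψ]
        exact h
      have := hφM _ hχ hχa _ (F.comp_mem hψ (F.inclusion_mem le_top)) hψa m⁻¹ (inv_mem hm)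
        fun x => by
          rw [← he]
          simp
      simpa using this

/-- Take `y = ψ⁻¹ c_g ψ`. Were it inner, `g` would induce an inner automorphism of the centric image
and so lie in it. -/
theorem exists_aut_of_mem_normalizer {E P : Subgroup S} {ψ : E →* P} (hψ : ψ ∈ F.hom E P)
    (hc : IsCentricIn (image ψ)) {g : S} (hg : g ∈ Subgroup.normalizer (image ψ : Set S))
    (hgE : g ∉ image ψ) :
    ∃ y : MulAut E, y ∉ inn E ∧ ∀ x, (ψ (y x) : S) = g * ψ x * g⁻¹ := by
  obtain ⟨e, he, -, -⟩ := F.factor hψ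
  have hy : ∀ x, (ψ (MulAut.congr e.symm ((image ψ).normalizerMonoidHom ⟨g, hg⟩) x) : S) =
      g * ψ x * g⁻¹ := by
    intro x
    rw [← he, ← he]
    change ((e (e.symm ((image ψ).normalizerMonoidHom ⟨g, hg⟩ (e x))) : image ψ) : S) = _
    rw [MulEquiv.apply_symm_apply]
    rfl
  refine ⟨_, ?_, hy⟩
  rintro ⟨z, hz⟩
  refine hgE (hc.mem_of_mem_inn (a := MulAut.conj (e z)) ⟨e z, rfl⟩ fun w => ?_)
  obtain ⟨x, rfl⟩ := e.surjective w
  rw [MulAut.conj_apply, ← map_inv, ← map_mul, ← map_mul, he, he, ← hy, ← hz]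
  rfl

/-- A morphism that transports the conjugation action of some `g ∈ N_S(E₀) \ E₀`, for every
conjugate `E₀` of `E` in its domain, to the action of an element of `S` is controlled. -/
theorem isControlled_of_forall_exists {E : Subgroup S} (hE : F.IsCentric E)
    {M : Subgroup (MulAut E)}
    (hM : ∀ k ∈ F.aut E, ∀ y ∈ autS E, y ∉ inn E → k * y * k⁻¹ ∈ autS E → k ∈ M)
    {P R : Subgroup S} {φ : P →* R}
    (h : ∀ E₀ ≤ P, F.Conj E E₀ → ∃ g ∈ Subgroup.normalizer (E₀ : Set S), g ∉ E₀ ∧ ∃ g' : S,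
      ∀ x y : P, (y : S) = g * x * g⁻¹ → (φ y : S) = g' * φ x * g'⁻¹) :
    F.IsControlled E M φ := by
  intro ψ hψ hψa ψ' hψ' hψa' m hm hx
  obtain ⟨g, hg, hgE, g', hg'⟩ := h _ (image_le ψ) (conj_image hψ)
  obtain ⟨y, hyI, hy⟩ := exists_aut_of_mem_normalizer hψ (hE _ (conj_image hψ)) hg hgE
  -- Adaptedness of `ψ` puts `y` in `Aut_S(E)`; that of `ψ'` puts `m y m⁻¹` there, realized by `g'`.
  refine hM m hm y (hψa ⟨g, hy⟩) hyI (hψa' ⟨g', fun x => ?_⟩)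
  have h1 := hg' _ _ (hy (m⁻¹ x))
  rw [hx, hx, MulAut.apply_inv_self] at h1
  exact h1

end FusionSystem

/-! ### Automizer sequences are Alperin sequences. -/

open FusionSystem

/-- Otherwise the controlled subsystem contains all generators, hence all of `F(D)`, and `Aut_F(E)`
would lie in `M`. -/
theorem FusionDatum.exists_conj_mem_seq {p : ℕ} [Fact p.Prime] [Finite S] (hS : IsPGroup p S)
    (D : FusionDatum S) (hF : D.fusionSystem.IsSaturated p) {E : Subgroup S}
    (hE : D.fusionSystem.IsEssential p E) : ∃ Q ∈ D.seq, D.fusionSystem.Conj E Q := by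
  by_contra! hno
  have hEA := hE.fullyNormalized.isFullyAutomized hS hF hE.centric
  obtain ⟨M, hM, hMc⟩ := exists_control hEA hE.stronglyEmbedded
  have hlt : ∀ E₀, D.fusionSystem.Conj E E₀ → E₀ < ⊤ := by
    intro E₀ h₀
    refine lt_top_iff_ne_top.mpr ?_
    rintro rfl
    exact hE.lt_top.ne h₀.symm.eq_top
  let G := D.fusionSystem.controlled E M (hEA.exists_isAdapted hS) (by
    rintro P R φ ⟨h, hh⟩
    refine isControlled_of_forall_exists hE.centric hMc fun E₀ _ h₀ => ?_
    obtain ⟨g, -, hg, hgE⟩ := exists_mem_normalizer_notMem hS (hlt _ h₀)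
    refine ⟨g, hg, hgE, h * g * h⁻¹, fun x y hxy => ?_⟩
    rw [hh, hh, hxy]; group)
  have hG : ∀ Q : Subgroup S, ∀ a ∈ {a : MulAut Q | ∃ hQ : Q ∈ D.seq, a ∈ D.A Q hQ},
      a.toMonoidHom ∈ G.hom Q Q := by
    rintro Q a ⟨hQ, ha⟩
    refine ⟨fun G hG => hG _ _ ⟨hQ, ha⟩, isControlled_of_forall_exists hE.centric hMc ?_⟩
    intro E₀ hle h₀
    -- The only use of the assumption that no member is conjugate to `E`; strictness yields `g`
    -- inside `Q`, where `a` is defined.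
    have hlt : E₀ < Q := lt_of_le_of_ne hle fun h => hno Q hQ (h ▸ h₀)
    obtain ⟨g, hgQ, hg, hgE⟩ := exists_mem_normalizer_notMem hS hlt
    refine ⟨g, hg, hgE, a ⟨g, hgQ⟩, fun x y hxy => ?_⟩
    obtain rfl : y = ⟨g, hgQ⟩ * x * ⟨g, hgQ⟩⁻¹ := Subtype.ext hxy
    simp
  refine hM fun m hm => ?_
  obtain ⟨-, hc⟩ := hm G hG
  exact hc _ (D.fusionSystem.refl_mem E) (isAdapted_id E) _
    (D.fusionSystem.inclusion_mem le_top) (isAdapted_id E) m hm fun x => rfl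

theorem FusionDatum.IsAutomizerSeq.isAlperinSeq {p : ℕ} [Fact p.Prime] [Finite S]
    (hS : IsPGroup p S) {D : FusionDatum S} (hD : D.IsAutomizerSeq p)
    (hF : D.fusionSystem.IsSaturated p) : D.IsAlperinSeq p D.fusionSystem := by
  have hess : ∀ Q ∈ D.seq, D.fusionSystem.IsEssential p Q ∨ Q = ⊤ := by
    intro Q hQ
    refine or_iff_not_imp_right.mpr fun hne => ?_
    have hs := hD.sylow Q hQ
    have he := hD.stronglyEmbedded Q hQ hne
    rw [hD.A_eq Q hQ] at hs he
    exact ⟨lt_top_iff_ne_top.mpr hne, hD.isCentric Q hQ,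
      IsFullyAutomized.isFullyNormalized hS hs (hD.isCentric Q hQ), he⟩
  refine ⟨hess, fun E hE => ?_, hD.A_eq⟩
  obtain ⟨Q, hQ, hEQ⟩ := D.exists_conj_mem_seq hS hF hE
  refine ⟨Q, hQ, (hess Q hQ).resolve_right ?_, hEQ⟩
  rintro rfl
  exact hE.lt_top.ne hEQ.symm.eq_top

/-! ### Receptive subgroups and Alperin's fusion theorem. -/

namespace FusionSystem

variable {F G : FusionSystem S}

theorem mem_extControl {P Q : Subgroup S} {α : P ≃* Q} {g : S}
    (hg : g ∈ Subgroup.normalizer (P : Set S))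
    (h : MulAut.congr α (P.normalizerMonoidHom ⟨g, hg⟩) ∈ autS Q) : g ∈ extControl α :=
  ⟨⟨g, hg⟩, h, rfl⟩

theorem centralizer_le_extControl {P Q : Subgroup S} (α : P ≃* Q) :
    Subgroup.centralizer (P : Set S) ≤ extControl α := by
  intro c hc
  refine mem_extControl (centralizer_le_normalizer P hc) ?_
  have h : P.normalizerMonoidHom ⟨c, centralizer_le_normalizer P hc⟩ = 1 := by
    rw [← MonoidHom.mem_ker, Subgroup.normalizerMonoidHom_ker]
    exact hc
  rw [h, map_one]
  exact one_mem _

/-- `N_α` contains `C_S(P)`, and the extension `β` of `α` sends it into `C_S(Q) ≤ Q = β(P)`;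
injectivity gives `C_S(P) ≤ P`. -/
theorem IsReceptive.isCentric {Q : Subgroup S} (hQ : F.IsReceptive Q) (hc : IsCentricIn Q) :
    F.IsCentric Q := by
  intro P hP
  obtain ⟨α, hα⟩ := hP.symm.exists_equiv
  obtain ⟨β, hβ, hβα⟩ := hQ P α hα
  refine isCentricIn_iff.mpr fun c hcP => ?_
  have hcN := centralizer_le_extControl α hcP
  have hβc : (β ⟨c, hcN⟩ : S) ∈ Q := by
    refine isCentricIn_iff.mp hc (Subgroup.mem_centralizer_iff.mpr fun q hq => ?_)
    have hq' : q = β (Subgroup.inclusion (le_extControl α) (α.symm ⟨q, hq⟩)) := by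
      rw [hβα]; simp
    rw [hq', ← Subgroup.coe_mul, ← Subgroup.coe_mul, ← map_mul, ← map_mul]
    congr 2
    exact Subtype.ext (Subgroup.mem_centralizer_iff.mp hcP _ (α.symm ⟨q, hq⟩).2)
  have h : β ⟨c, hcN⟩ = β (Subgroup.inclusion (le_extControl α) (α.symm ⟨_, hβc⟩)) :=
    Subtype.ext (by rw [hβα]; simp)
  have h2 := congrArg Subtype.val (F.injective hβ h)
  change c = (α.symm ⟨_, hβc⟩ : P) at h2
  rw [h2]
  exact Subtype.prop _

/-- If all `F`-morphisms out of groups larger than a receptive group `Q` are in `G`, then so is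
every `F`-isomorphism onto `Q` whose extension control group is larger than its domain. -/
theorem IsReceptive.mem_of_extControl [Finite S] {Q : Subgroup S} (hQ : F.IsReceptive Q)
    (hG : ∀ R : Subgroup S, Nat.card Q < Nat.card R → F.hom R ⊤ ⊆ G.hom R ⊤)
    {P : Subgroup S} {α : P ≃* Q} (hα : α.toMonoidHom ∈ F.hom P Q) {g : S}
    (hg : g ∈ extControl α) (hgP : g ∉ P) : α.toMonoidHom ∈ G.hom P Q := by
  obtain ⟨β, hβ, hβα⟩ := hQ P α hα
  have hlt : P < extControl α := lt_of_le_of_ne (le_extControl α) fun h => hgP (h ▸ hg)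
  have hcard : Nat.card Q < Nat.card (extControl α) := by
    rw [← Nat.card_congr α.toEquiv]
    refine lt_of_le_of_ne (Subgroup.card_le_of_le hlt.le) fun h => ?_
    exact hlt.ne (Subgroup.eq_of_le_of_card_ge hlt.le h.ge)
  exact mem_of_agree (hG _ hcard hβ) (le_extControl α) fun x => (hβα x).symm

/-- Choose `m` by Sylow to conjugate `α Aut_S(P) α⁻¹` into `Aut_S(Q)`. Then the extension control
group of `mα` is all of `N_S(P)`, which exceeds `P`. -/
theorem exists_aut_trans_mem {p : ℕ} [Fact p.Prime] [Finite S] (hS : IsPGroup p S)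
    {Q : Subgroup S} (hQA : F.IsFullyAutomized p Q) (hQ : F.IsReceptive Q) (hne : Q ≠ ⊤)
    (hG : ∀ R : Subgroup S, Nat.card Q < Nat.card R → F.hom R ⊤ ⊆ G.hom R ⊤)
    {P : Subgroup S} {α : P ≃* Q} (hα : α.toMonoidHom ∈ F.hom P Q) :
    ∃ m ∈ F.aut Q, (α.trans m).toMonoidHom ∈ G.hom P Q := by
  have hs := symm_mem_hom hα
  obtain ⟨m, hm, hmT⟩ := IsSylowOf.exists_conj_mem hQA (autVia_le_aut hs)
    (isPGroup_autVia hS (subtype_comp_injective hs))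
  have hPtop : P < ⊤ := by
    refine lt_top_iff_ne_top.mpr ?_
    rintro rfl
    exact hne (conj_of_equiv hα).eq_top
  obtain ⟨g, -, hg, hgP⟩ := exists_mem_normalizer_notMem hS hPtop
  refine ⟨m, hm, hQ.mem_of_extControl hG (trans_mem hα hm) (mem_extControl hg ?_) hgP⟩
  have := hmT (MulAut.congr α (P.normalizerMonoidHom ⟨g, hg⟩)) ⟨g, fun x => ?_⟩
  · exact this
  · change ((α.symm (α (P.normalizerMonoidHom ⟨g, hg⟩ (α.symm x))) : P) : S) = _
    rw [MulEquiv.symm_apply_apply]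
    rfl

/-- The witness comes from `Aut_F(Q) ∩ Aut_G(Q)`. If `k` carries a noninner `c_g` into `Aut_S(Q)`,
then `g ∈ N_k \ Q`, so `k` extends to a larger group and lies in `G`. -/
theorem hasStronglyEmbedded_of_not_aut_le {p : ℕ} [Fact p.Prime] [Finite S] (hS : IsPGroup p S)
    {Q : Subgroup S} (hQA : F.IsFullyAutomized p Q) (hQ : F.IsReceptive Q) (hne : Q ≠ ⊤)
    (hc : IsCentricIn Q)
    (hG : ∀ R : Subgroup S, Nat.card Q < Nat.card R → F.hom R ⊤ ⊆ G.hom R ⊤)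
    (hnot : ¬ F.aut Q ≤ G.aut Q) : HasStronglyEmbedded p (Out (F.aut Q)) := by
  obtain ⟨U, hU⟩ := hQA
  have hmem : ∀ y : F.aut Q, y ∈ U ↔ (y : MulAut Q) ∈ autS Q := by
    intro y
    rw [← hU]
    refine ⟨fun hy => ⟨y, hy, rfl⟩, ?_⟩
    rintro ⟨z, hz, hzy⟩
    obtain rfl : z = y := Subtype.ext hzy
    exact hz
  refine hasStronglyEmbedded_quotient_of_control _ U (M := (G.aut Q).subgroupOf (F.aut Q))
    ?_ ?_ ?_ ?_
  · refine lt_of_le_of_ne (fun y hy => (hmem y).mpr (inn_le_autS Q hy)) fun h => ?_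
    obtain ⟨g, -, hg, hgQ⟩ := exists_mem_normalizer_notMem hS (lt_top_iff_ne_top.mpr hne)
    have hgS : Q.normalizerMonoidHom ⟨g, hg⟩ ∈ autS Q := ⟨_, rfl⟩
    have hgU : (⟨_, autS_le_aut Q hgS⟩ : F.aut Q) ∈ (U : Subgroup (F.aut Q)) := (hmem _).mpr hgS
    rw [← h] at hgU
    exact hgQ (hc.mem_of_mem_inn (Subgroup.mem_subgroupOf.mp hgU) fun x => rfl)
  · exact fun y hy => autS_le_aut Q ((hmem y).mp hy)
  · exact fun h => hnot (Subgroup.subgroupOf_eq_top.mp h)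
  · intro k y hy hyI hky
    obtain ⟨g, hg⟩ := (hmem y).mp hy
    refine hQ.mem_of_extControl hG k.2 (mem_extControl g.2 ?_) fun hgQ => hyI ?_
    · rw [Subtype.coe_eta, hg]
      exact (hmem _).mp hky
    · refine Subgroup.mem_subgroupOf.mpr ⟨⟨g, hgQ⟩, ?_⟩
      rw [← hg]
      ext x
      rfl

/-- **Alperin's fusion theorem**: a saturated fusion system is generated by the automorphisms of
`S` and of representatives of the conjugacy classes of essential subgroups. -/
theorem IsSaturated.hom_subset {p : ℕ} [Fact p.Prime] [Finite S] (hS : IsPGroup p S)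
    (hF : F.IsSaturated p) (htop : F.aut ⊤ ≤ G.aut ⊤)
    (hess : ∀ E, F.IsEssential p E → ∃ Q, F.Conj E Q ∧ F.aut Q ≤ G.aut Q) (P : Subgroup S) :
    F.hom P ⊤ ⊆ G.hom P ⊤ := by
  induction hn : Nat.card S - Nat.card P using Nat.strong_induction_on generalizing P with
  | _ n ih =>
  subst hn
  have hG : ∀ R : Subgroup S, Nat.card P < Nat.card R → F.hom R ⊤ ⊆ G.hom R ⊤ := by
    intro R hR
    have := Subgroup.card_le_card_group R
    exact ih _ (by omega) R rfl
  intro φ hφ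
  obtain ⟨e, he, hem, -⟩ := F.factor hφ
  suffices h : e.toMonoidHom ∈ G.hom P (image φ) from
    mem_of_agree h le_rfl fun x => (he x).symm
  by_cases hP : P = ⊤
  · subst hP
    have hi := (conj_of_equiv hem).eq_top
    revert e
    rw [hi]
    intro e he hem
    exact htop hem
  obtain ⟨Q, hPQ, hQA, hQ⟩ := hF P
  rw [hPQ.card_eq] at hG
  have hne : Q ≠ ⊤ := by
    rintro rfl
    exact hP hPQ.symm.eq_top
  have haut : F.aut Q ≤ G.aut Q := by
    by_cases hc : IsCentricIn Q
    · by_contra hnot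
      have hcF := hQ.isCentric hc
      obtain ⟨Q₀, hQ₀, hle⟩ := hess Q ⟨lt_top_iff_ne_top.mpr hne, hcF,
        hQA.isFullyNormalized hS hcF, hasStronglyEmbedded_of_not_aut_le hS hQA hQ hne hc hG hnot⟩
      obtain ⟨α, hα⟩ := hQ₀.symm.exists_equiv
      obtain ⟨m, hm, hmG⟩ := exists_aut_trans_mem hS hQA hQ hne hG hα
      refine hnot fun a ha => ?_
      have hF' := trans_mem hα hm
      -- As `mα` lies in both systems, it transports `Aut_F(Q₀) ≤ Aut_G(Q₀)` to `Q`.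
      have h1 : ((α.trans m).trans (MulEquiv.trans a (α.trans m).symm) : MulAut Q₀) ∈ F.aut Q₀ :=
        trans_mem hF' (trans_mem ha (symm_mem_hom hF'))
      have h2 := trans_mem (symm_mem_hom hmG) (trans_mem (hle h1) hmG)
      refine mem_of_agree h2 le_rfl fun x => ?_
      simp
      rfl
    -- An element of `C_S(Q) \ Q` lies in every `N_a`, so each `a ∈ Aut_F(Q)` extends.
    · rw [isCentricIn_iff] at hc
      obtain ⟨c, hcC, hcQ⟩ := SetLike.not_le_iff_exists.mp hc
      exact fun a ha => hQ.mem_of_extControl hG ha (centralizer_le_extControl a hcC) hcQ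
  obtain ⟨α, hα⟩ := hPQ.exists_equiv
  have hα' := trans_mem (symm_mem_hom hem) hα
  obtain ⟨m, hm, hmG⟩ := exists_aut_trans_mem hS hQA hQ hne hG hα
  obtain ⟨m', hm', hmG'⟩ := exists_aut_trans_mem hS hQA hQ hne hG hα'
  -- With `α' = α e⁻¹`, this is the factorization `e = (m'α')⁻¹ (m' m⁻¹) (mα)` with all three
  -- factors in `G`.
  have h := trans_mem hmG (trans_mem (haut (mul_mem hm' (inv_mem hm))) (symm_mem_hom hmG'))
  refine mem_of_agree h le_rfl fun x => ?_
  simp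
  rfl

end FusionSystem

/-! ### Alperin sequences generate `F` and are automizer sequences. -/

open FusionSystem

theorem FusionDatum.IsAlperinSeq.eq_fusionSystem {p : ℕ} [Fact p.Prime] [Finite S]
    (hS : IsPGroup p S) {D : FusionDatum S} {F : FusionSystem S} (hF : F.IsSaturated p)
    (hD : D.IsAlperinSeq p F) : F = D.fusionSystem := by
  have hA : ∀ Q ∈ D.seq, F.aut Q ≤ D.fusionSystem.aut Q := fun Q hQ a ha G hG =>
    hG _ _ ⟨hQ, by rwa [hD.A_eq]⟩
  have htop := hA ⊤ (List.mem_of_head? D.head_eq)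
  have hess : ∀ E, F.IsEssential p E → ∃ Q, F.Conj E Q ∧ F.aut Q ≤ D.fusionSystem.aut Q := by
    intro E hE
    obtain ⟨Q, hQ, -, hEQ⟩ := hD.exists_rep E hE
    exact ⟨Q, hEQ, hA Q hQ⟩
  ext P Q φ
  constructor
  · intro hφ
    exact mem_of_agree (hF.hom_subset hS htop hess P
      (F.comp_mem hφ (F.inclusion_mem le_top))) le_rfl fun x => rfl
  · refine fun hφ => hφ F ?_
    rintro R a ⟨hR, ha⟩
    rwa [hD.A_eq] at ha

theorem FusionDatum.IsAlperinSeq.isAutomizerSeq {p : ℕ} [Fact p.Prime] [Finite S]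
    (hS : IsPGroup p S) {D : FusionDatum S} {F : FusionSystem S} (hF : F.IsSaturated p)
    (hD : D.IsAlperinSeq p F) : D.IsAutomizerSeq p := by
  obtain rfl := hD.eq_fusionSystem hS hF
  have hcen : ∀ Q ∈ D.seq, D.fusionSystem.IsCentric Q := by
    intro Q hQ
    rcases hD.essential_or_top Q hQ with h | rfl
    · exact h.centric
    · exact isCentric_top
  have hnorm : ∀ Q ∈ D.seq, D.fusionSystem.IsFullyNormalized Q := by
    intro Q hQ
    rcases hD.essential_or_top Q hQ with h | rfl
    · exact h.fullyNormalized
    · intro R hR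
      rw [hR.eq_top]
  refine ⟨hD.A_eq, hcen, fun Q hQ => ?_, fun Q hQ hne => ?_⟩
  · rw [hD.A_eq Q hQ]
    exact (hnorm Q hQ).isFullyAutomized hS hF (hcen Q hQ)
  · rw [hD.A_eq Q hQ]
    exact ((hD.essential_or_top Q hQ).resolve_right hne).stronglyEmbedded

end Fusion

theorem proposition3 {S : Type*} [Group S] [Finite S] (p : ℕ) [Fact p.Prime]
    (hS : IsPGroup p S) (D : Fusion.FusionDatum S) :
    (D.IsAutomizerSeq p → D.fusionSystem.IsSaturated p →
      D.IsAlperinSeq p D.fusionSystem) ∧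
    ∀ F : Fusion.FusionSystem S, F.IsSaturated p → D.IsAlperinSeq p F →
      D.IsAutomizerSeq p ∧ F = D.fusionSystem :=
  ⟨fun hD hF => hD.isAlperinSeq hS hF,
    fun _ hF hD => ⟨hD.isAutomizerSeq hS hF, hD.eq_fusionSystem hS hF⟩⟩
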